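/- A metric space $(\mathcal M,d)$ is an NPC space if any two points are joined by a geodesic (a map $\gamma:[0,1]\to\mathcal M$ with $d(\gamma(s),\gamma(t))=(t-s)\,d(\gamma(0),\gamma(1))$ for $0\le s\le t\le 1$) and, for every $p\in\mathcal M$, every geodesic $\gamma$ and every $t\in[0,1]$, $$d^2(p,\gamma(t))\le(1-t)\,d^2(p,\gamma(0))+t\,d^2(p,\gamma(1))-t(1-t)\,d^2(\gamma(0),\gamma(1)).$$ A function on $\mathcal M$ is geodesically concave if it is concave along every geodesic. $\mathcal P_2(\mathcal M)$ is the set of Borel probability measures $P$ on $\mathcal M$ with $\int d^2(x,y)\,\mathrm dP(y)<\infty$ for all $x$, and a barycenter of $P\in\mathcal P_2(\mathcal M)$ is a minimizer of $x\mapsto\int d^2(x,y)\,\mathrm dP(y)$ over $\mathcal M$. For probability measures $q,\pi$, $D(q\|\pi)=\int\ln(\mathrm dq/\mathrm d\pi)\,\mathrm dq$ if $q\ll\pi$, and $D(q\|\pi)=+\infty$ otherwise. Let $(\mathcal M,d)$ be a complete NPC space with its Borel $\sigma$-algebra, $\mathcal Z$ a measurable space, and $\ell:\mathcal M\times\mathcal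 Z\to\mathbb R$ a jointly measurable loss such that $\ell(\cdot,z)$ is lower semicontinuous for every $z\in\mathcal Z$. Let $\beta>0$ be such that $e^{-\beta\ell(\cdot,z)}$ is geodesically concave for every $z\in\mathcal Z$. Let $\Theta\subset\mathcal M$, let $\pi$ be a probability measure (prior) on $\Theta$, let $n\ge1$, and let $Z_1,\dots,Z_n$ be i.i.d. $\mathcal Z$-valued random variables with the same distribution as, and independent of, a random variable $Z$. For $1\le i\le n+1$ and $z_1,\dots,z_{i-1}\in\mathcal Z$ let $$\mathrm d\pi_i(\theta)=\frac{e^{-\beta\sum_{j=1}^{i-1}\ell(\theta,z_j)}\,\mathrm d\pi(\theta)}{\int_\Theta e^{-\beta\sum_{j=1}^{i-1}\ell(\vartheta,z_j)}\,\mathrm d\pi(\vartheta)}$$ (so $\pi_1=\pi$). Suppose that $\pi_i$, seen as a measure on $\mathcal M$, always belongs to $\mathcal P_2(\mathcal M)$, and let $m_i(z_1,\dots,z_{i-1})$ be its barycenter. Let $\theta_n=\theta_n(Z_1,\dots,Z_n)$ be the barycenter of the uniform measure on the forecasts, i.e. $$\theta_n\in\underset{m\in\mathcal M}{\arg\min}\sum_{i=1}^{n+1}d^2\big(m,m_i(Z_1,\dots,Z_{i-1})\big).$$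 The maps $m_i$ and $\theta_n$ are taken to be measurable functions of the outcomes. Suppose finally that the expectations involved are well defined in $(-\infty,+\infty]$: writing $\ell^-=\max(-\ell,0)$, $\int_\Theta\mathbb E[\ell^-(\theta,Z)]\,\mathrm dq(\theta)<\infty$ for every probability measure $q$ on $\Theta$, $\mathbb E[\ell^-(m_i(Z_1,\dots,Z_{i-1}),Z)]<\infty$ for $1\le i\le n+1$, and $\mathbb E[\ell^-(\theta_n,Z)]<\infty$ (this is automatic for nonnegative or bounded losses). Then: 1. $$\mathbb E[\ell(\theta_n,Z)]\le\inf_q\left\{\int_\Theta\mathbb E[\ell(\theta,Z)]\,\mathrm dq(\theta)+\frac{D(q\|\pi)}{\beta(n+1)}\right\}.$$ 2. If in addition there is $\lambda>0$ such that $\ell(\cdot,z)$ is $\lambda$-Lipschitz for every $z\in\mathcal Z$, and if $\theta^*\in\Theta$ minimizes $\theta\mapsto\mathbb E[\ell(\theta,Z)]$ over $\Theta$, with $\mathbb E[\ell(\theta^*,Z)]<\infty$, then $$\mathbb E[\ell(\theta_n,Z)]-\inf_{\theta\in\Theta}\mathbb E[\ell(\theta,Z)]\le\inf_q\left\{\lambda\int_\Theta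 d(\theta^*,\theta)\,\mathrm dq(\theta)+\frac{D(q\|\pi)}{\beta(n+1)}\right\}.$$ In both parts the infimum runs over all probability measures $q$ on $\Theta$; both sides may be $+\infty$. -/

import Mathlib

open MeasureTheory ProbabilityTheory
open scoped ENNReal NNReal

noncomputable section

/-- `γ`, restricted to `[0,1]`, is a (constant speed, minimising) geodesic. -/
def IsGeodesicPath {M : Type*} [MetricSpace M] (γ : ℝ → M) : Prop :=
  ∀ s t : ℝ, 0 ≤ s → s ≤ t → t ≤ 1 → dist (γ s) (γ t) = (t - s) * dist (γ 0) (γ 1)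

/-- Any two points are joined by a geodesic. -/
def IsGeodesicSpace (M : Type*) [MetricSpace M] : Prop :=
  ∀ x y : M, ∃ γ : ℝ → M, IsGeodesicPath γ ∧ γ 0 = x ∧ γ 1 = y

/-- Geodesic spaces of non-positive curvature in the sense of Alexandrov. -/
def IsNPCSpace (M : Type*) [MetricSpace M] : Prop :=
  IsGeodesicSpace M ∧
    ∀ (p : M) (γ : ℝ → M), IsGeodesicPath γ → ∀ t ∈ Set.Icc (0 : ℝ) 1,
      dist p (γ t) ^ 2 ≤
        (1 - t) * dist p (γ 0) ^ 2 + t * dist p (γ 1) ^ 2 - t * (1 - t) * dist (γ 0) (γ 1) ^ 2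

/-- Convexity along every geodesic. -/
def GeodesicallyConvex {M : Type*} [MetricSpace M] (f : M → ℝ) : Prop :=
  ∀ γ : ℝ → M, IsGeodesicPath γ → ConvexOn ℝ (Set.Icc (0 : ℝ) 1) (fun t => f (γ t))

/-- `f` is geodesically concave if `-f` is geodesically convex. -/
def GeodesicallyConcave {M : Type*} [MetricSpace M] (f : M → ℝ) : Prop :=
  GeodesicallyConvex (fun x => -f x)

/-- The class `𝒫₂(M)` of probability measures with finite second moments. -/
def MemP2 {M : Type*} [MetricSpace M] [MeasurableSpace M] (P : Measure M) : Prop :=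
  IsProbabilityMeasure P ∧ ∀ x : M, Integrable (fun y => dist x y ^ 2) P

/-- `x` minimises `∫ d(x, y)² dP(y)` over `M` (used for `P ∈ 𝒫₂(M)` only). -/
def IsBarycenter {M : Type*} [MetricSpace M] [MeasurableSpace M] (P : Measure M) (x : M) : Prop :=
  ∀ x' : M, ∫ y, dist x y ^ 2 ∂P ≤ ∫ y, dist x' y ^ 2 ∂P

/-- Integral, with values in `[-∞, +∞]`, of an extended real function: the integral of the positive
part minus that of the negative part. It is used only where the latter is finite. -/
def extIntegral {α : Type*} [MeasurableSpace α] (μ : Measure α) (f : α → EReal) : EReal :=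
  ((∫⁻ x, (f x).toENNReal ∂μ : ℝ≥0∞) : EReal) - ((∫⁻ x, (-f x).toENNReal ∂μ : ℝ≥0∞) : EReal)

/-- The exponentially weighted posterior on the expert set `Θ` after the outcomes `z`:
`dπ(θ)` reweighted by `exp(-β ∑ⱼ ℓ(θ, zⱼ))` and normalised. -/
def ewaPosterior {M 𝒵 : Type*} [MeasurableSpace M] {Θ : Set M} (prior : Measure Θ) (β : ℝ)
    (ℓ : M → 𝒵 → ℝ) {k : ℕ} (z : Fin k → 𝒵) : Measure Θ :=
  prior.tilted (fun θ => -β * ∑ j, ℓ θ (z j))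

/-- The posterior as a measure on the decision space: push-forward by `Θ ⊆ M`. -/
def ewaLaw {M 𝒵 : Type*} [MeasurableSpace M] {Θ : Set M} (prior : Measure Θ) (β : ℝ)
    (ℓ : M → 𝒵 → ℝ) {k : ℕ} (z : Fin k → 𝒵) : Measure M :=
  (ewaPosterior prior β ℓ z).map Subtype.val

/-- The first `k` of `n` outcomes, for `k ≤ n`. -/
def outcomePrefix {𝒵 : Type*} {n : ℕ} (z : Fin n → 𝒵) (k : Fin (n + 1)) : Fin k → 𝒵 :=
  fun j => z (Fin.castLE (Nat.le_of_lt_succ k.isLt) j)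

/-- The `(k+1)`-st forecast, `0 ≤ k ≤ n`, is the generalised EWA forecast: a barycenter of the
exponentially weighted posterior after `k` outcomes, which has to lie in `𝒫₂(M)`. -/
def IsEWAForecaster {M 𝒵 : Type*} [MetricSpace M] [MeasurableSpace M] {Θ : Set M}
    (prior : Measure Θ) (β : ℝ) (ℓ : M → 𝒵 → ℝ) {n : ℕ}
    (m : (k : Fin (n + 1)) → (Fin k → 𝒵) → M) : Prop :=
  ∀ (k : Fin (n + 1)) (z : Fin k → 𝒵),
    MemP2 (ewaLaw prior β ℓ z) ∧ IsBarycenter (ewaLaw prior β ℓ z) (m k z)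

/-- Online-to-batch estimator: a minimiser over `M` of the sum of squared distances to the
`n + 1` forecasts built from the batch `z`. -/
def IsOnlineToBatch {M 𝒵 : Type*} [MetricSpace M] {n : ℕ}
    (m : (k : Fin (n + 1)) → (Fin k → 𝒵) → M) (est : (Fin n → 𝒵) → M) : Prop :=
  ∀ (z : Fin n → 𝒵) (x : M),
    ∑ k, dist (est z) (m k (outcomePrefix z k)) ^ 2 ≤ ∑ k, dist x (m k (outcomePrefix z k)) ^ 2

/-- The risk `E[ℓ(x, Z)]` of a fixed decision `x`. -/
def risk {M 𝒵 Ω : Type*} [MeasurableSpace Ω] (μ : Measure Ω) (ℓ : M → 𝒵 → ℝ) (Z : Ω → 𝒵)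
    (x : M) : EReal :=
  extIntegral μ (fun ω => ((ℓ x (Z ω) : ℝ) : EReal))

/-- The risk `E[ℓ(est(Z₁, …, Zₙ), Z)]` of an estimator. -/
def estimatorRisk {M 𝒵 Ω : Type*} [MeasurableSpace Ω] (μ : Measure Ω) (ℓ : M → 𝒵 → ℝ) {n : ℕ}
    (Zs : Fin n → Ω → 𝒵) (Z : Ω → 𝒵) (est : (Fin n → 𝒵) → M) : EReal :=
  extIntegral μ (fun ω => ((ℓ (est (fun i => Zs i ω)) (Z ω) : ℝ) : EReal))

end

/-! ### Jensen's inequality at a barycenter -/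

section Jensen

open Filter Topology

/-! The geometric core is Jensen's inequality at a barycenter `b`
(`IsNPCSpace.integral_le_of_geodesicallyConcave`). Let `s` be the mean of a concave `f`, and project
`(b, s)` onto the hypograph of `f` in `M × ℝ`. The obtuse-angle inequality at the projection,
integrated and compared with the minimality of `b`, makes the projection distance zero; so `(b, s)`
lies in the hypograph, that is, `s ≤ f b`.

For `exp (-β ℓ(·, z))` and a posterior, Jensen bounds the posterior mean by the value at the
forecast. Multiplied over the rounds, these means telescope to one normalising constant
(`lintegral_exp_sum_le`), and the Donsker-Varadhan inequality turns its bound into a regret of at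
most `D(q‖π)/β` against any `q`.

The rounds are run on the `n + 1` outcomes `Z₁, …, Zₙ, Z`, whence the factor `1/(n+1)`. In
expectation, the outcome a forecast faces may be replaced by `Z`, since the forecast depends on
earlier outcomes only. Jensen for the uniform measure on the forecasts then bounds the loss of the
estimator by their average loss. The second part bounds the risk at `θ` by the minimal risk plus the
Lipschitz constant times the distance to the minimiser. -/

/-- A nonnegative lower semicontinuous function on a complete metric space that is uniformly
midpoint convex attains its minimum. -/
theorem exists_forall_le_of_midpoint_convex {M : Type*} [MetricSpace M] [CompleteSpace M]
    [Nonempty M] {Φ : M → ℝ} (h0 : ∀ x, 0 ≤ Φ x) (hlsc : LowerSemicontinuous Φ)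
    (hmid : ∀ x y, ∃ z, Φ z ≤ (Φ x + Φ y) / 2 - dist x y ^ 2 / 4) :
    ∃ x, ∀ x', Φ x ≤ Φ x' := by
  have hbdd : BddBelow (Set.range Φ) := ⟨0, by rintro _ ⟨x, rfl⟩; exact h0 x⟩
  have hle : ∀ x, iInf Φ ≤ Φ x := fun x => ciInf_le hbdd x
  have hex : ∀ k : ℕ, ∃ x, Φ x < iInf Φ + 1 / ((k : ℝ) + 1) := fun k =>
    exists_lt_of_ciInf_lt (lt_add_of_pos_right _ (by positivity))
  choose u hu using hex
  have hlim := tendsto_one_div_add_atTop_nhds_zero_nat (𝕜 := ℝ)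
  have hcauchy : CauchySeq u := by
    -- A midpoint value is at least the infimum, so `dist² / 4` is at most the average excess of the
    -- two points over the infimum.
    refine cauchySeq_of_le_tendsto_0 (fun N : ℕ => √(4 * (1 / ((N : ℝ) + 1)))) ?_ ?_
    · intro k l N hk hl
      refine Real.le_sqrt_of_sq_le ?_
      obtain ⟨z, hz⟩ := hmid (u k) (u l)
      have h1 := hle z
      have hk' : 1 / ((k : ℝ) + 1) ≤ 1 / ((N : ℝ) + 1) := by gcongr
      have hl' : 1 / ((l : ℝ) + 1) ≤ 1 / ((N : ℝ) + 1) := by gcongr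
      linarith [hu k, hu l]
    · have := (hlim.const_mul 4).sqrt
      simpa using this
  obtain ⟨x, hx⟩ := cauchySeq_tendsto_of_complete hcauchy
  refine ⟨x, fun x' => le_trans (le_of_forall_lt fun c hc => ?_) (hle x')⟩
  obtain ⟨c', hcc', hc'⟩ := exists_between hc
  have h1 : ∀ᶠ k : ℕ in atTop, c' ≤ iInf Φ + 1 / ((k : ℝ) + 1) := by
    filter_upwards [hx.eventually (hlsc x c' hc')] with k hk using (hk.trans (hu k)).le
  have h2 := ge_of_tendsto (hlim.const_add (iInf Φ)) h1
  linarith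

/-- The inequality satisfied along a geodesic from `x` to `y` by the distance to the hypograph of a
geodesically concave function. -/
theorem IsNPCSpace.sq_dist_add_sq_posPart_le {M : Type*} [MetricSpace M] (hM : IsNPCSpace M)
    {f : M → ℝ} (hf : GeodesicallyConcave f) (b : M) (s : ℝ) {x : M} {r r' : ℝ} (y : M)
    (hr : r ≤ f x) (hr' : r' ≤ f y) {t : ℝ} (ht : t ∈ Set.Icc (0 : ℝ) 1) :
    ∃ z, dist b z ^ 2 + max (s - f z) 0 ^ 2 ≤
      (1 - t) * dist b x ^ 2 + t * dist b y ^ 2 - t * (1 - t) * dist x y ^ 2 +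
        max (s - ((1 - t) * r + t * r')) 0 ^ 2 := by
  obtain ⟨γ, hγ, rfl, rfl⟩ := hM.1 x y
  refine ⟨γ t, add_le_add (hM.2 b γ hγ t ht) ?_⟩
  have h := (hf γ hγ).2 (Set.left_mem_Icc.2 zero_le_one) (Set.right_mem_Icc.2 zero_le_one)
    (sub_nonneg.2 ht.2) ht.1 (by ring)
  simp only [smul_eq_mul, mul_zero, zero_add, mul_one] at h
  have h1 := mul_le_mul_of_nonneg_left hr (sub_nonneg.2 ht.2)
  have h2 := mul_le_mul_of_nonneg_left hr' ht.1
  gcongr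
  linarith

/-- Existence of the nearest point to `(b, s)` in the hypograph of a geodesically concave upper
semicontinuous function. -/
theorem IsNPCSpace.exists_minimizer_hypograph {M : Type*} [MetricSpace M] [CompleteSpace M]
    (hM : IsNPCSpace M) {f : M → ℝ} (hf : GeodesicallyConcave f) (husc : UpperSemicontinuous f)
    (b : M) (s : ℝ) :
    ∃ x, ∀ x', dist b x ^ 2 + max (s - f x) 0 ^ 2 ≤ dist b x' ^ 2 + max (s - f x') 0 ^ 2 := by
  have : Nonempty M := ⟨b⟩
  have hanti : Antitone fun u : ℝ => max (s - u) 0 ^ 2 := fun u v huv => by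
    dsimp only; gcongr
  refine exists_forall_le_of_midpoint_convex (Φ := fun x => dist b x ^ 2 + max (s - f x) 0 ^ 2)
    (fun x => by positivity) ?_ fun x y => ?_
  · have h1 : Continuous fun x : M => dist b x ^ 2 := by fun_prop
    have h2 : Continuous fun u : ℝ => max (s - u) 0 ^ 2 := by fun_prop
    exact h1.lowerSemicontinuous.add (h2.comp_upperSemicontinuous_antitone husc hanti)
  · obtain ⟨z, hz⟩ := hM.sq_dist_add_sq_posPart_le hf b s (x := x) y le_rfl le_rfl (t := 1 / 2)
      (by constructor <;> norm_num)
    refine ⟨z, hz.trans ?_⟩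
    have h : max (s - ((1 - 1 / 2) * f x + 1 / 2 * f y)) 0 ≤
        (max (s - f x) 0 + max (s - f y) 0) / 2 := by
      refine max_le ?_ (by positivity)
      linarith [le_max_left (s - f x) 0, le_max_left (s - f y) 0]
    have h' := pow_le_pow_left₀ (le_max_right _ _) h 2
    nlinarith [sq_nonneg (max (s - f x) 0 - max (s - f y) 0)]

/-- Jensen's inequality in a complete NPC space, for a random point `φ` with barycenter `b`. -/
theorem IsNPCSpace.integral_le_of_geodesicallyConcave {M : Type*} [MetricSpace M] [CompleteSpace M]
    (hM : IsNPCSpace M) {f : M → ℝ} (hf : GeodesicallyConcave f) (husc : UpperSemicontinuous f)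
    {α : Type*} [MeasurableSpace α] {P : Measure α} [IsProbabilityMeasure P] {φ : α → M}
    (hφ : ∀ x, Integrable (fun a => dist x (φ a) ^ 2) P) (hfφ : Integrable (fun a => f (φ a)) P)
    {b : M} (hb : ∀ x, ∫ a, dist b (φ a) ^ 2 ∂P ≤ ∫ a, dist x (φ a) ^ 2 ∂P) :
    ∫ a, f (φ a) ∂P ≤ f b := by
  set s := ∫ a, f (φ a) ∂P with hs
  obtain ⟨x, hx⟩ := hM.exists_minimizer_hypograph hf husc b s
  -- The nearest point of the hypograph to `(b, s)` is `(x, r)`.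
  set r := min s (f x) with hr
  have hrx : max (s - f x) 0 = s - r := by
    rcases le_total s (f x) with h | h <;> simp [hr, h]
  -- Obtuse angle at `(x, r)`: the squared distance from `(b, s)` to `(y, f y)` is at least the sum
  -- of the squared distances of both points to `(x, r)`. The squares in the height coordinate
  -- combine to the product term.
  have key : ∀ y, 0 ≤ dist b y ^ 2 - dist b x ^ 2 - dist x y ^ 2 - 2 * (s - r) * (f y - r) := by
    intro y
    by_contra! hA
    set A := dist b y ^ 2 - dist b x ^ 2 - dist x y ^ 2 - 2 * (s - r) * (f y - r) with hAdef
    set B := dist x y ^ 2 + (f y - r) ^ 2 with hBdef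
    have hB : 0 ≤ B := by positivity
    have hD : 0 < B + 1 - A := by linarith
    -- Minimality gives `A + t * B ≥ 0` on `(0, 1]`. This explicit small `t` replaces the limit `t →
    -- 0` and contradicts `A < 0`.
    set t := -A / (B + 1 - A) with ht
    have ht0 : 0 < t := div_pos (by linarith) hD
    have ht1 : t ≤ 1 := by rw [ht, div_le_one hD]; linarith
    have htD : t * (B + 1 - A) = -A := div_mul_cancel₀ _ hD.ne'
    obtain ⟨z, hz⟩ := hM.sq_dist_add_sq_posPart_le hf b s (x := x) y (min_le_right s (f x)) le_rfl
      ⟨ht0.le, ht1⟩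
    have h1 := (hx z).trans hz
    rw [hrx] at h1
    have h2 : max (s - ((1 - t) * r + t * f y)) 0 ^ 2 ≤ (s - ((1 - t) * r + t * f y)) ^ 2 := by
      rw [← sq_abs (s - _)]
      gcongr
      exact max_le (le_abs_self _) (abs_nonneg _)
    have h3 : 0 ≤ t * (A + t * B) := by
      have : t * (A + t * B) = (1 - t) * dist b x ^ 2 + t * dist b y ^ 2
          - t * (1 - t) * dist x y ^ 2 + (s - ((1 - t) * r + t * f y)) ^ 2
          - (dist b x ^ 2 + (s - r) ^ 2) := by
        rw [hAdef, hBdef]; ring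
      rw [this]; linarith
    have h4 : 0 ≤ A + t * B := nonneg_of_mul_nonneg_right h3 ht0
    nlinarith
  have hint := integral_nonneg_of_ae (μ := P) (.of_forall fun a => key (φ a))
  have hi1 := hφ b
  have hi2 := hφ x
  have hi3 : Integrable (fun a => f (φ a) - r) P := hfφ.sub (integrable_const r)
  rw [integral_sub (by fun_prop) (hi3.const_mul _), integral_sub (by fun_prop) hi2,
    integral_sub hi1 (integrable_const _), integral_const_mul,
    integral_sub hfφ (integrable_const _), ← hs] at hint
  simp only [integral_const, probReal_univ, one_smul] at hint
  -- With `hint`, this leaves `dist b x ^ 2 + 2 * (s - r) ^ 2 ≤ 0`.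
  have hbx := hb x
  have h1 : (s - r) ^ 2 = 0 := by nlinarith [sq_nonneg (s - r), sq_nonneg (dist b x)]
  have h2 : dist b x ^ 2 = 0 := by nlinarith [sq_nonneg (s - r), sq_nonneg (dist b x)]
  have h3 : b = x := by simpa using h2
  have h4 : s = r := by simpa [sub_eq_zero] using h1
  rw [h3, h4]
  exact min_le_right _ _

/-- Truncation makes a nonnegative concave function bounded, hence integrable; monotone convergence
then removes the truncation. -/
theorem GeodesicallyConcave.min_const {M : Type*} [MetricSpace M] {f : M → ℝ}
    (hf : GeodesicallyConcave f) (K : ℝ) : GeodesicallyConcave fun x => min (f x) K := by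
  intro γ hγ
  have h := (hf γ hγ).sup (convexOn_const (-K) (convex_Icc (0 : ℝ) 1))
  refine h.congr fun t _ => ?_
  simp [max_neg_neg]

/-- Jensen's inequality for a nonnegative function, without integrability assumption. -/
theorem IsNPCSpace.lintegral_le_of_geodesicallyConcave {M : Type*} [MetricSpace M]
    [CompleteSpace M] [MeasurableSpace M] [BorelSpace M]
    (hM : IsNPCSpace M) {f : M → ℝ} (hf : GeodesicallyConcave f) (husc : UpperSemicontinuous f)
    (hf0 : ∀ x, 0 ≤ f x) {P : Measure M} (hP : MemP2 P) {b : M} (hb : IsBarycenter P b) :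
    ∫⁻ x, ENNReal.ofReal (f x) ∂P ≤ ENNReal.ofReal (f b) := by
  have := hP.1
  have hmeas : Measurable f := husc.measurable
  have hsup : ∀ x, ENNReal.ofReal (f x) = ⨆ K : ℕ, ENNReal.ofReal (min (f x) K) := by
    intro x
    refine le_antisymm ?_ (iSup_le fun K => ENNReal.ofReal_le_ofReal (min_le_left _ _))
    obtain ⟨K, hK⟩ := exists_nat_ge (f x)
    exact le_iSup_of_le K (by rw [min_eq_left hK])
  simp_rw [hsup]
  rw [lintegral_iSup (fun K => (hmeas.min measurable_const).ennreal_ofReal)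
    (fun K L hKL x => ENNReal.ofReal_le_ofReal (min_le_min_left _ (by exact_mod_cast hKL)))]
  refine iSup_mono fun K => ?_
  have hK0 : ∀ x, 0 ≤ min (f x) (K : ℝ) := fun x => le_min (hf0 x) K.cast_nonneg
  have hint : Integrable (fun x => min (f x) (K : ℝ)) P :=
    Integrable.of_bound (hmeas.min measurable_const).aestronglyMeasurable K
      (.of_forall fun x => by rw [Real.norm_of_nonneg (hK0 x)]; exact min_le_right _ _)
  rw [← ofReal_integral_eq_lintegral_ofReal hint (.of_forall hK0)]
  refine ENNReal.ofReal_le_ofReal ?_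
  refine hM.integral_le_of_geodesicallyConcave (hf.min_const K) ?_ hP.2 hint hb
  exact (continuous_id.min continuous_const).comp_upperSemicontinuous husc
    (fun u v h => min_le_min_right _ h)

end Jensen

/-! ### Exponential averages, normalising constants and relative entropy -/

/-- Jensen's inequality for the exponential of a loss and a minimiser of the sum of squared
distances to finitely many points. -/
theorem IsNPCSpace.le_sum_div_of_forall_sum_sq_dist_le {M : Type*} [MetricSpace M]
    [CompleteSpace M] (hM : IsNPCSpace M) {g : M → ℝ} (hg : LowerSemicontinuous g) {β : ℝ}
    (hβ : 0 < β) (hconc : GeodesicallyConcave fun x => Real.exp (-β * g x)) {n : ℕ}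
    (x : Fin (n + 1) → M) {b : M} (hb : ∀ x', ∑ k, dist b (x k) ^ 2 ≤ ∑ k, dist x' (x k) ^ 2) :
    g b ≤ ∑ k, ((n : ℝ) + 1)⁻¹ * g (x k) := by
  have husc : UpperSemicontinuous fun x => Real.exp (-β * g x) :=
    Continuous.comp_lowerSemicontinuous_antitone (g := fun u => Real.exp (-β * u)) (by fun_prop) hg
      fun u v huv => Real.exp_le_exp.2 (by nlinarith)
  set P := (PMF.uniformOfFintype (Fin (n + 1))).toMeasure
  have hP : ∀ h : Fin (n + 1) → ℝ, ∫ k, h k ∂P = ∑ k, ((n : ℝ) + 1)⁻¹ * h k := fun h => by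
    rw [PMF.integral_eq_sum]
    simp [PMF.uniformOfFintype_apply, ENNReal.toReal_add]
  have h1 := hM.integral_le_of_geodesicallyConcave hconc husc (P := P) (φ := x) (b := b)
    (fun _ => .of_finite) .of_finite fun x' => by
      rw [hP, hP, ← Finset.mul_sum, ← Finset.mul_sum]
      exact mul_le_mul_of_nonneg_left (hb x') (by positivity)
  rw [hP] at h1
  -- Scalar convexity of `exp` passes from the mean of exponentials to the exponential of the mean
  -- loss.
  have h2 := convexOn_exp.map_sum_le (t := Finset.univ)
    (w := fun _ : Fin (n + 1) => ((n : ℝ) + 1)⁻¹) (p := fun k => -β * g (x k)) (fun _ _ => by positivity)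
    (by simp; field_simp) (fun _ _ => Set.mem_univ _)
  simp only [smul_eq_mul] at h2
  have h3 := Real.exp_le_exp.1 (h2.trans h1)
  have h4 : ∑ k, ((n : ℝ) + 1)⁻¹ * (-β * g (x k)) = -β * ∑ k, ((n : ℝ) + 1)⁻¹ * g (x k) := by
    rw [Finset.mul_sum]
    exact Finset.sum_congr rfl fun _ _ => by ring
  rw [h4] at h3
  nlinarith

/-- One telescoping step: a further weight multiplies the normalising constant by its mean under the
current tilted measure. -/
theorem lintegral_exp_tilted {α : Type*} [MeasurableSpace α] {ν : Measure α} {f : α → ℝ}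
    (hf : Integrable (fun x => Real.exp (f x)) ν) [NeZero ν] (g : α → ℝ) :
    ∫⁻ x, ENNReal.ofReal (Real.exp (f x + g x)) ∂ν =
      (∫⁻ x, ENNReal.ofReal (Real.exp (f x)) ∂ν) *
        ∫⁻ x, ENNReal.ofReal (Real.exp (g x)) ∂(ν.tilted f) := by
  have hpos := integral_exp_pos hf
  rw [lintegral_tilted, ← ofReal_integral_eq_lintegral_ofReal hf (.of_forall fun _ => by positivity),
    ← lintegral_const_mul' _ _ ENNReal.ofReal_ne_top]
  refine lintegral_congr fun x => ?_
  rw [← ENNReal.ofReal_mul (by positivity), ← ENNReal.ofReal_mul (by positivity), Real.exp_add]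
  congr 1
  field_simp

/-- Telescoping of the normalising constants of successive exponential reweightings. -/
theorem lintegral_exp_sum_le {α : Type*} [MeasurableSpace α] {ν : Measure α}
    [IsProbabilityMeasure ν] {N : ℕ} (g : Fin N → α → ℝ) (c : Fin N → ℝ)
    (hprob : ∀ k : Fin N,
      IsProbabilityMeasure (ν.tilted fun θ => ∑ j : Fin k, g (Fin.castLE k.isLt.le j) θ))
    (h : ∀ k : Fin N,
      ∫⁻ θ, ENNReal.ofReal (Real.exp (g k θ))
        ∂(ν.tilted fun θ => ∑ j : Fin k, g (Fin.castLE k.isLt.le j) θ) ≤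
      ENNReal.ofReal (Real.exp (c k))) :
    ∫⁻ θ, ENNReal.ofReal (Real.exp (∑ k, g k θ)) ∂ν ≤ ENNReal.ofReal (Real.exp (∑ k, c k)) := by
  induction N with
  | zero => simp
  | succ N ih =>
    have h1 := ih (fun k => g k.castSucc) (fun k => c k.castSucc) (fun k => hprob k.castSucc)
      (fun k => h k.castSucc)
    have hp : IsProbabilityMeasure (ν.tilted fun θ => ∑ j : Fin N, g j.castSucc θ) :=
      hprob (Fin.last N)
    have h2 : ∫⁻ θ, ENNReal.ofReal (Real.exp (g (Fin.last N) θ))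
        ∂(ν.tilted fun θ => ∑ j : Fin N, g j.castSucc θ) ≤
        ENNReal.ofReal (Real.exp (c (Fin.last N))) := h (Fin.last N)
    -- `Measure.tilted` is zero by default when the weight is not integrable, so being a probability
    -- measure forces integrability.
    have hint : Integrable (fun θ => Real.exp (∑ j : Fin N, g j.castSucc θ)) ν := by
      by_contra hcon
      rw [tilted_of_not_integrable hcon] at hp
      exact hp.ne_zero _ rfl
    simp_rw [Fin.sum_univ_castSucc]
    rw [lintegral_exp_tilted hint, Real.exp_add, ENNReal.ofReal_mul (by positivity)]
    exact mul_le_mul' h1 h2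

/-- The variational inequality of Donsker and Varadhan. -/
theorem integral_le_log_integral_exp_add_klDiv {α : Type*} [MeasurableSpace α] {q ν : Measure α}
    [IsProbabilityMeasure q] [IsProbabilityMeasure ν] {f : α → ℝ} (hf : Integrable f q)
    (hexp : Integrable (fun x => Real.exp (f x)) ν) (hkl : InformationTheory.klDiv q ν ≠ ∞) :
    ∫ x, f x ∂q ≤
      Real.log (∫ x, Real.exp (f x) ∂ν) + (InformationTheory.klDiv q ν).toReal := by
  obtain ⟨hac, hllr⟩ := InformationTheory.klDiv_ne_top_iff.1 hkl
  have := isProbabilityMeasure_tilted hexp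
  -- Nonnegativity of the divergence of `q` from `ν.tilted f`, expanded below.
  have h1 := InformationTheory.integral_llr_add_sub_measure_univ_nonneg
    (hac.trans (absolutelyContinuous_tilted hexp)) (integrable_llr_tilted_right hac hf hllr hexp)
  have h2 := InformationTheory.toReal_klDiv hac hllr
  rw [integral_llr_tilted_right hac hf hexp hllr] at h1
  simp only [probReal_univ] at h1 h2
  linarith

/-! ### Regret of the exponentially weighted forecaster -/

section Forecaster

variable {M 𝒵 : Type*} [MetricSpace M] [CompleteSpace M] [MeasurableSpace M] [BorelSpace M]
  {Θ : Set M} {prior : Measure Θ} {β : ℝ} {ℓ : M → 𝒵 → ℝ} {n : ℕ}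
  {m : (k : Fin (n + 1)) → (Fin k → 𝒵) → M}

/-- The exponentially weighted forecaster satisfies the mixability bound at every round. -/
theorem IsEWAForecaster.lintegral_exp_le (hewa : IsEWAForecaster prior β ℓ m)
    (hM : IsNPCSpace M) (hlsc : ∀ z, LowerSemicontinuous fun x => ℓ x z) (hβ : 0 < β)
    (hconc : ∀ z, GeodesicallyConcave fun x => Real.exp (-β * ℓ x z))
    (k : Fin (n + 1)) (z : Fin k → 𝒵) (y : 𝒵) :
    IsProbabilityMeasure (ewaPosterior prior β ℓ z) ∧
      ∫⁻ θ, ENNReal.ofReal (Real.exp (-β * ℓ θ y)) ∂(ewaPosterior prior β ℓ z) ≤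
        ENNReal.ofReal (Real.exp (-β * ℓ (m k z) y)) := by
  obtain ⟨hP, hb⟩ := hewa k z
  have husc : UpperSemicontinuous fun x => Real.exp (-β * ℓ x y) :=
    Continuous.comp_lowerSemicontinuous_antitone (g := fun u => Real.exp (-β * u)) (by fun_prop)
      (hlsc y) fun u v huv => Real.exp_le_exp.2 (by nlinarith)
  have h := hM.lintegral_le_of_geodesicallyConcave (hconc y) husc
    (fun x => (Real.exp_pos _).le) hP hb
  rw [ewaLaw, lintegral_map husc.measurable.ennreal_ofReal measurable_subtype_coe] at h
  refine ⟨?_, h⟩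
  have := hP.1
  rw [ewaLaw] at this
  exact Measure.isProbabilityMeasure_of_map (Subtype.val : Θ → M)

/-- Regret bound of the exponentially weighted forecaster relative to a randomised expert `q`. -/
theorem IsEWAForecaster.sum_loss_le [IsProbabilityMeasure prior]
    (hewa : IsEWAForecaster prior β ℓ m)
    (hM : IsNPCSpace M) (hlsc : ∀ z, LowerSemicontinuous fun x => ℓ x z) (hβ : 0 < β)
    (hconc : ∀ z, GeodesicallyConcave fun x => Real.exp (-β * ℓ x z))
    {q : Measure Θ} [IsProbabilityMeasure q] (hkl : InformationTheory.klDiv q prior ≠ ∞)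
    (y : Fin (n + 1) → 𝒵) (hy : ∀ k, Integrable (fun θ : Θ => ℓ θ (y k)) q) :
    ∑ k, ℓ (m k fun j => y (Fin.castLE k.isLt.le j)) (y k) ≤
      ∑ k, ∫ θ, ℓ (θ : M) (y k) ∂q + (InformationTheory.klDiv q prior).toReal / β := by
  have hround := fun k : Fin (n + 1) => hewa.lintegral_exp_le hM hlsc hβ hconc k
    (fun j => y (Fin.castLE k.isLt.le j)) (y k)
  simp only [ewaPosterior, Finset.mul_sum] at hround
  have htel := lintegral_exp_sum_le (ν := prior) (fun k (θ : Θ) => -β * ℓ θ (y k))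
    (fun k => -β * ℓ (m k fun j => y (Fin.castLE k.isLt.le j)) (y k))
    (fun k => (hround k).1) (fun k => (hround k).2)
  have hmeas : Measurable fun θ : Θ => Real.exp (∑ k, -β * ℓ (θ : M) (y k)) := by
    have := fun k => (hlsc (y k)).measurable
    fun_prop
  have hexp : Integrable (fun θ : Θ => Real.exp (∑ k, -β * ℓ (θ : M) (y k))) prior := by
    refine ⟨hmeas.aestronglyMeasurable, ?_⟩
    rw [hasFiniteIntegral_iff_ofReal (.of_forall fun _ => (Real.exp_pos _).le)]
    exact htel.trans_lt ENNReal.ofReal_lt_top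
  rw [← ofReal_integral_eq_lintegral_ofReal hexp (.of_forall fun _ => (Real.exp_pos _).le),
    ENNReal.ofReal_le_ofReal_iff (Real.exp_pos _).le,
    ← Real.log_le_iff_le_exp (integral_exp_pos hexp)] at htel
  have hdv := integral_le_log_integral_exp_add_klDiv
    (integrable_finsetSum _ fun k _ => (hy k).const_mul (-β)) hexp hkl
  rw [integral_finsetSum _ fun k _ => (hy k).const_mul (-β)] at hdv
  simp_rw [integral_const_mul] at hdv
  rw [← Finset.mul_sum] at hdv htel
  have h := hdv.trans (add_le_add_left htel _)
  rw [← mul_le_mul_iff_of_pos_left hβ, mul_add, mul_div_cancel₀ _ hβ.ne']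
  linarith

end Forecaster

/-! ### Extended integrals and Fubini -/

section ExtIntegral

variable {α : Type*} [MeasurableSpace α]

theorem extIntegral_mono_ae {μ : Measure α} {f g : α → EReal} (h : f ≤ᵐ[μ] g) :
    extIntegral μ f ≤ extIntegral μ g := by
  unfold extIntegral
  refine EReal.sub_le_sub ?_ ?_
  · exact EReal.coe_ennreal_le_coe_ennreal_iff.2
      (lintegral_mono_ae (h.mono fun x hx => EReal.toENNReal_le_toENNReal hx))
  · exact EReal.coe_ennreal_le_coe_ennreal_iff.2
      (lintegral_mono_ae (h.mono fun x hx =>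
        EReal.toENNReal_le_toENNReal (EReal.neg_le_neg_iff.2 hx)))

theorem extIntegral_congr_ae {μ : Measure α} {f g : α → EReal} (h : f =ᵐ[μ] g) :
    extIntegral μ f = extIntegral μ g :=
  le_antisymm (extIntegral_mono_ae h.le) (extIntegral_mono_ae h.symm.le)

theorem extIntegral_coe_eq_lintegral_sub (μ : Measure α) (f : α → ℝ) :
    extIntegral μ (fun x => (f x : EReal)) =
      ((∫⁻ x, ENNReal.ofReal (f x) ∂μ : ℝ≥0∞) : EReal) -
        ((∫⁻ x, ENNReal.ofReal (-f x) ∂μ : ℝ≥0∞) : EReal) := by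
  simp only [extIntegral, ← EReal.coe_neg, EReal.real_coe_toENNReal]

theorem extIntegral_coe {μ : Measure α} {f : α → ℝ} (hf : Integrable f μ) :
    extIntegral μ (fun x => (f x : EReal)) = ((∫ x, f x ∂μ : ℝ) : EReal) := by
  have h1 : ∫⁻ x, ENNReal.ofReal (f x) ∂μ ≠ ∞ := hf.lintegral_lt_top.ne
  have h2 : ∫⁻ x, ENNReal.ofReal (-f x) ∂μ ≠ ∞ := hf.neg.lintegral_lt_top.ne
  rw [extIntegral_coe_eq_lintegral_sub, integral_eq_lintegral_pos_part_sub_lintegral_neg_part hf,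
    EReal.coe_sub, EReal.coe_ennreal_toReal h1, EReal.coe_ennreal_toReal h2]

theorem extIntegral_coe_map {𝒵 : Type*} [MeasurableSpace 𝒵] {μ : Measure α} {Z : α → 𝒵}
    (hZ : Measurable Z) {f : 𝒵 → ℝ} (hf : Measurable f) :
    extIntegral (μ.map Z) (fun z => (f z : EReal)) = extIntegral μ fun ω => (f (Z ω) : EReal) := by
  simp only [extIntegral_coe_eq_lintegral_sub]
  rw [lintegral_map (by fun_prop) hZ, lintegral_map (by fun_prop) hZ]

theorem integrable_of_lintegral_ofReal_lt_top {μ : Measure α} {f : α → ℝ} (hf : Measurable f)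
    (hpos : ∫⁻ x, ENNReal.ofReal (f x) ∂μ < ∞) (hneg : ∫⁻ x, ENNReal.ofReal (-f x) ∂μ < ∞) :
    Integrable f μ := by
  refine ⟨hf.aestronglyMeasurable, ?_⟩
  refine lt_of_le_of_lt (lintegral_mono fun x => ?_)
    ((lintegral_add_left hf.ennreal_ofReal _).trans_lt (ENNReal.add_lt_top.2 ⟨hpos, hneg⟩))
  rcases le_total 0 (f x) with h | h
  · rw [Real.enorm_of_nonneg h]; exact le_self_add
  · rw [← enorm_neg, Real.enorm_of_nonneg (neg_nonneg.2 h)]; exact le_add_self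

theorem integrable_of_ae_le {μ : Measure α} {f g : α → ℝ} (hf : Measurable f)
    (hneg : ∫⁻ x, ENNReal.ofReal (-f x) ∂μ < ∞) (hg : Integrable g μ) (hfg : f ≤ᵐ[μ] g) :
    Integrable f μ :=
  integrable_of_lintegral_ofReal_lt_top hf
    ((lintegral_mono_ae (hfg.mono fun _ h => ENNReal.ofReal_le_ofReal h)).trans_lt
      hg.lintegral_lt_top) hneg

/-- If the sum of finitely many functions has an integrable upper bound and each of them has an
integrable negative part, then all of them are integrable. -/
theorem integrable_of_sum_ae_le {ι : Type*} [Fintype ι] {μ : Measure α} {f : ι → α → ℝ}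
    {g : α → ℝ} (hf : ∀ i, Measurable (f i))
    (hneg : ∀ i, ∫⁻ x, ENNReal.ofReal (-f i x) ∂μ < ∞) (hg : Integrable g μ)
    (hfg : ∀ᵐ x ∂μ, ∑ i, f i x ≤ g x) (i : ι) : Integrable (f i) μ := by
  classical
  have hmax : ∀ j, Integrable (fun x => max (-f j x) 0) μ := fun j => by
    have := hf j
    refine integrable_of_lintegral_ofReal_lt_top (by fun_prop) ?_ ?_
    · simpa [ENNReal.ofReal_max] using hneg j
    · have : ∀ x, ENNReal.ofReal (-max (-f j x) 0) = 0 := fun x => by simp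
      simp [this]
  -- Isolating one summand: `f i` is at most `g` plus the negative parts of the others.
  refine integrable_of_ae_le (hf i) (hneg i)
    (hg.add (integrable_finsetSum (Finset.univ.erase i) fun j _ => hmax j)) ?_
  filter_upwards [hfg] with x hx
  rw [← Finset.add_sum_erase _ _ (Finset.mem_univ i)] at hx
  have h : -∑ j ∈ Finset.univ.erase i, f j x ≤ ∑ j ∈ Finset.univ.erase i, max (-f j x) 0 := by
    rw [← Finset.sum_neg_distrib]
    exact Finset.sum_le_sum fun j _ => le_max_left _ _
  simp only [Pi.add_apply]
  linarith

variable {γ : Type*} [MeasurableSpace γ] {q : Measure α} {ν : Measure γ} {F : α → γ → ℝ}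

theorem lintegral_toENNReal_neg_extIntegral_le :
    ∫⁻ a, (-extIntegral ν fun z => (F a z : EReal)).toENNReal ∂q ≤
      ∫⁻ a, ∫⁻ z, ENNReal.ofReal (-F a z) ∂ν ∂q := by
  refine lintegral_mono fun a => ?_
  rw [extIntegral_coe_eq_lintegral_sub]
  by_cases hB : ∫⁻ z, ENNReal.ofReal (-F a z) ∂ν = ∞
  · rw [hB]; exact le_top
  · rw [EReal.neg_sub (.inl (EReal.coe_ennreal_ne_bot _)) (.inr (by simpa using hB)), add_comm,
      ← sub_eq_add_neg, EReal.toENNReal_sub (EReal.coe_ennreal_nonneg _)]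
    simp

theorem extIntegral_extIntegral_ne_bot
    (hneg : ∫⁻ a, ∫⁻ z, ENNReal.ofReal (-F a z) ∂ν ∂q < ∞) :
    extIntegral q (fun a => extIntegral ν fun z => (F a z : EReal)) ≠ ⊥ := by
  have h := (lintegral_toENNReal_neg_extIntegral_le (q := q) (ν := ν) (F := F)).trans_lt hneg
  rw [extIntegral, sub_eq_add_neg, EReal.add_ne_bot_iff]
  simpa using h.ne

/-- Since `A ≤ B + (A - B)⁺` for the inner positive and negative parts `A`, `B`, finiteness of the
iterated integral also controls the positive part. -/
theorem integrable_uncurry_of_extIntegral_ne_top [SFinite q] [SFinite ν]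
    (hF : Measurable (Function.uncurry F))
    (hneg : ∫⁻ a, ∫⁻ z, ENNReal.ofReal (-F a z) ∂ν ∂q < ∞)
    (htop : extIntegral q (fun a => extIntegral ν fun z => (F a z : EReal)) ≠ ⊤) :
    Integrable (Function.uncurry F) (q.prod ν) := by
  have hA : Measurable fun a => ∫⁻ z, ENNReal.ofReal (F a z) ∂ν :=
    Measurable.lintegral_prod_right' (f := fun p : α × γ => ENNReal.ofReal (F p.1 p.2))
      hF.ennreal_ofReal
  have hB : Measurable fun a => ∫⁻ z, ENNReal.ofReal (-F a z) ∂ν :=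
    Measurable.lintegral_prod_right' (f := fun p : α × γ => ENNReal.ofReal (-F p.1 p.2))
      hF.neg.ennreal_ofReal
  have h := (lintegral_toENNReal_neg_extIntegral_le (q := q) (ν := ν) (F := F)).trans_lt hneg
  have hpos : ∫⁻ a, (extIntegral ν fun z => (F a z : EReal)).toENNReal ∂q ≠ ∞ := by
    intro hcon
    refine htop ?_
    rw [extIntegral, hcon, EReal.coe_ennreal_top]
    exact EReal.top_sub (by simpa using h.ne)
  refine integrable_of_lintegral_ofReal_lt_top hF ?_ ?_
  · rw [lintegral_prod _ hF.ennreal_ofReal.aemeasurable]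
    have hle : ∀ a, ∫⁻ z, ENNReal.ofReal (F a z) ∂ν ≤
        (∫⁻ z, ENNReal.ofReal (-F a z) ∂ν) +
          (extIntegral ν fun z => (F a z : EReal)).toENNReal := fun a => by
      rw [extIntegral_coe_eq_lintegral_sub, EReal.toENNReal_sub (EReal.coe_ennreal_nonneg _)]
      simpa using le_add_tsub
    refine (lintegral_mono hle).trans_lt ?_
    rw [lintegral_add_left hB]
    exact ENNReal.add_lt_top.2 ⟨hneg, hpos.lt_top⟩
  · refine (lintegral_prod _ ?_).trans_lt hneg
    exact hF.neg.ennreal_ofReal.aemeasurable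

theorem extIntegral_extIntegral_eq_integral [SFinite q] [SFinite ν]
    (hF : Integrable (Function.uncurry F) (q.prod ν)) :
    extIntegral q (fun a => extIntegral ν fun z => (F a z : EReal)) =
      ((∫ p, Function.uncurry F p ∂(q.prod ν) : ℝ) : EReal) := by
  rw [integral_prod _ hF, ← extIntegral_coe hF.integral_prod_left]
  exact extIntegral_congr_ae (hF.prod_right_ae.mono fun a ha => extIntegral_coe ha)

end ExtIntegral

/-! ### From online forecasts to the batch estimator -/

section OnlineToBatch

variable {M : Type*} [MeasurableSpace M] {𝒵 : Type*} [MeasurableSpace 𝒵] {n : ℕ}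
  {Ω : Type*} [MeasurableSpace Ω] {μ : Measure Ω} {Zs : Fin n → Ω → 𝒵} {Z : Ω → 𝒵}

theorem snoc_castLE_eq_outcomePrefix {𝒵 : Type*} {n : ℕ} (z : Fin n → 𝒵) (z' : 𝒵)
    (k : Fin (n + 1)) :
    (fun j : Fin k => (Fin.snoc z z' : Fin (n + 1) → 𝒵) (Fin.castLE k.isLt.le j)) =
      outcomePrefix z k := by
  funext j
  exact Fin.snoc_castSucc (α := fun _ => 𝒵) z' z (Fin.castLE (Nat.le_of_lt_succ k.isLt) j)

theorem measurable_outcomePrefix (hZs : ∀ i, Measurable (Zs i)) (k : Fin (n + 1)) :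
    Measurable fun ω => outcomePrefix (fun i => Zs i ω) k :=
  measurable_pi_lambda _ fun _ => hZs _

theorem identDistrib_snoc (hident : ∀ i, IdentDistrib (Zs i) Z μ μ) (hZ : Measurable Z)
    (k : Fin (n + 1)) :
    IdentDistrib (fun ω => (Fin.snoc (fun i => Zs i ω) (Z ω) : Fin (n + 1) → 𝒵) k) Z μ μ := by
  refine Fin.lastCases ?_ (fun i => ?_) k
  · simp only [Fin.snoc_last]
    exact IdentDistrib.refl hZ.aemeasurable
  · simpa using hident i

/-- For `k = n` the next outcome is `Z`, independent of the batch; for `k < n` prefix and next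
outcome use disjoint indices of the batch. -/
theorem indepFun_outcomePrefix_snoc [IsProbabilityMeasure μ] (hZs : ∀ i, Measurable (Zs i))
    (hindep : iIndepFun Zs μ) (hindepZ : IndepFun (fun ω i => Zs i ω) Z μ) (k : Fin (n + 1)) :
    IndepFun (fun ω => outcomePrefix (fun i => Zs i ω) k)
      (fun ω => (Fin.snoc (fun i => Zs i ω) (Z ω) : Fin (n + 1) → 𝒵) k) μ := by
  have hpre : ∀ k : Fin (n + 1), Measurable fun z : Fin n → 𝒵 => outcomePrefix z k := fun k =>
    measurable_pi_lambda _ fun _ => measurable_pi_apply _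
  refine Fin.lastCases ?_ (fun i => ?_) k
  · simp only [Fin.snoc_last]
    exact hindepZ.comp (hpre _) measurable_id
  · have h := hindep.indepFun_finset (Finset.Iio i) {i} (by simp) hZs
    have hφ : Measurable fun (f : Finset.Iio i → 𝒵) (j : Fin (i.castSucc : Fin (n + 1))) =>
        f ⟨Fin.castLE (Nat.le_of_lt_succ i.castSucc.isLt) j, by
          simp [Fin.lt_def]⟩ :=
      measurable_pi_lambda _ fun _ => measurable_pi_apply _
    have hψ : Measurable fun f : ({i} : Finset (Fin n)) → 𝒵 => f ⟨i, by simp⟩ :=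
      measurable_pi_apply _
    simp only [Fin.snoc_castSucc]
    exact h.comp hφ hψ

/-- A forecast based on the past outcomes has the same joint law with the next outcome as with a
fresh one. -/
theorem identDistrib_forecast_snoc [IsProbabilityMeasure μ] (hZs : ∀ i, Measurable (Zs i))
    (hZ : Measurable Z) (hindep : iIndepFun Zs μ) (hindepZ : IndepFun (fun ω i => Zs i ω) Z μ)
    (hident : ∀ i, IdentDistrib (Zs i) Z μ μ) {m : (k : Fin (n + 1)) → (Fin k → 𝒵) → M}
    (hm : ∀ k, Measurable (m k)) (k : Fin (n + 1)) :
    IdentDistrib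
      (fun ω => (m k (outcomePrefix (fun i => Zs i ω) k),
        (Fin.snoc (fun i => Zs i ω) (Z ω) : Fin (n + 1) → 𝒵) k))
      (fun ω => (m k (outcomePrefix (fun i => Zs i ω) k), Z ω)) μ μ := by
  have hpre : Measurable fun z : Fin n → 𝒵 => outcomePrefix z k :=
    measurable_pi_lambda _ fun _ => measurable_pi_apply _
  exact (IdentDistrib.refl ((hm k).comp (measurable_outcomePrefix hZs k)).aemeasurable).prodMk
    (identDistrib_snoc hident hZ k)
    ((indepFun_outcomePrefix_snoc hZs hindep hindepZ k).comp (hm k) measurable_id)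
    (hindepZ.comp ((hm k).comp hpre) measurable_id)

variable [MetricSpace M] [CompleteSpace M] [BorelSpace M] {ℓ : M → 𝒵 → ℝ} {β : ℝ} {Θ : Set M}
  {prior : Measure Θ}

/-- The excess risk bound of the online-to-batch estimator against a randomised expert `q` with
finite risk and finite divergence from the prior. -/
theorem estimatorRisk_le_integral_add (hM : IsNPCSpace M) (hℓ : Measurable (Function.uncurry ℓ))
    (hlsc : ∀ z, LowerSemicontinuous (fun x => ℓ x z)) (hβ : 0 < β)
    (hconc : ∀ z, GeodesicallyConcave (fun x => Real.exp (-β * ℓ x z)))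
    [IsProbabilityMeasure prior] [IsProbabilityMeasure μ]
    (hZs : ∀ i, Measurable (Zs i)) (hZ : Measurable Z)
    (hindep : iIndepFun Zs μ) (hindepZ : IndepFun (fun ω i => Zs i ω) Z μ)
    (hident : ∀ i, IdentDistrib (Zs i) Z μ μ)
    {m : (k : Fin (n + 1)) → (Fin k → 𝒵) → M} (hm : ∀ k, Measurable (m k))
    (hewa : IsEWAForecaster prior β ℓ m)
    {est : (Fin n → 𝒵) → M} (hest : Measurable est) (hotb : IsOnlineToBatch m est)
    (hneg_m : ∀ k, ∫⁻ ω, ENNReal.ofReal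
      (-ℓ (m k (outcomePrefix (fun i => Zs i ω) k)) (Z ω)) ∂μ < ∞)
    (hneg_est : ∫⁻ ω, ENNReal.ofReal (-ℓ (est (fun i => Zs i ω)) (Z ω)) ∂μ < ∞)
    {q : Measure Θ} [IsProbabilityMeasure q] (hkl : InformationTheory.klDiv q prior ≠ ∞)
    (hint : Integrable (Function.uncurry fun (θ : Θ) z => ℓ θ z) (q.prod (μ.map Z))) :
    estimatorRisk μ ℓ Zs Z est ≤
      ((∫ p, Function.uncurry (fun (θ : Θ) z => ℓ θ z) p ∂(q.prod (μ.map Z)) +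
        (InformationTheory.klDiv q prior).toReal / (β * (n + 1)) : ℝ) : EReal) := by
  have hν : IsProbabilityMeasure (μ.map Z) := Measure.isProbabilityMeasure_map hZ.aemeasurable
  set R := ∫ p, Function.uncurry (fun (θ : Θ) z => ℓ θ z) p ∂(q.prod (μ.map Z)) with hR
  set D := (InformationTheory.klDiv q prior).toReal with hD
  let Y : Fin (n + 1) → Ω → 𝒵 := fun k ω =>
    (Fin.snoc (fun i => Zs i ω) (Z ω) : Fin (n + 1) → 𝒵) k
  let X : Fin (n + 1) → Ω → M := fun k ω => m k (outcomePrefix (fun i => Zs i ω) k)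
  have hX : ∀ k, Measurable (X k) := fun k => (hm k).comp (measurable_outcomePrefix hZs k)
  have hYlaw : ∀ k, IdentDistrib (Y k) Z μ μ := identDistrib_snoc hident hZ
  have hY : ∀ k, Measurable (Y k) := fun k => by
    refine Fin.lastCases ?_ (fun i => ?_) k
    · simpa [Y] using hZ
    · simpa [Y] using hZs i
  have hXY : ∀ k, IdentDistrib (fun ω => ℓ (X k ω) (Y k ω)) (fun ω => ℓ (X k ω) (Z ω)) μ μ :=
    fun k => (identDistrib_forecast_snoc hZs hZ hindep hindepZ hident hm k).comp hℓ
  -- averages of the loss over `q`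
  have havg : Integrable (fun z => ∫ θ, ℓ (θ : M) z ∂q) (μ.map Z) := hint.integral_prod_right
  have havg_eq : ∫ z, ∫ θ, ℓ (θ : M) z ∂q ∂(μ.map Z) = R := (integral_prod_symm _ hint).symm
  have hYavg : ∀ k, Integrable (fun ω => ∫ θ, ℓ (θ : M) (Y k ω) ∂q) μ := fun k => by
    rw [← (hYlaw k).map_eq] at havg
    exact havg.comp_measurable (hY k)
  have hYavg_eq : ∀ k, ∫ ω, ∫ θ, ℓ (θ : M) (Y k ω) ∂q ∂μ = R := fun k => by
    rw [← havg_eq, ← (hYlaw k).map_eq, integral_map (hY k).aemeasurable]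
    rw [(hYlaw k).map_eq]
    exact havg.aestronglyMeasurable
  have hYint : ∀ᵐ ω ∂μ, ∀ k, Integrable (fun θ : Θ => ℓ θ (Y k ω)) q := by
    refine ae_all_iff.2 fun k => ?_
    have h := hint.prod_left_ae
    rw [← (hYlaw k).map_eq] at h
    exact ae_of_ae_map (hY k).aemeasurable h
  -- regret of the forecasts
  have hregret : ∀ᵐ ω ∂μ, ∑ k, ℓ (X k ω) (Y k ω) ≤
      ∑ k, ∫ θ, ℓ (θ : M) (Y k ω) ∂q + D / β := by
    filter_upwards [hYint] with ω hω
    have h := hewa.sum_loss_le hM hlsc hβ hconc hkl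
      (Fin.snoc (fun i => Zs i ω) (Z ω) : Fin (n + 1) → 𝒵) hω
    simpa only [snoc_castLE_eq_outcomePrefix] using h
  have hbound : Integrable (fun ω => ∑ k, ∫ θ, ℓ (θ : M) (Y k ω) ∂q + D / β) μ :=
    (integrable_finsetSum _ fun k _ => hYavg k).add (integrable_const _)
  -- The negative parts, assumed finite for `Z`, transfer to `Y k` by equality of laws; the regret
  -- bound supplies the upper control.
  have hc : ∀ k, Integrable (fun ω => ℓ (X k ω) (Y k ω)) μ := by
    refine integrable_of_sum_ae_le (fun k => hℓ.comp ((hX k).prodMk (hY k))) (fun k => ?_)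
      hbound hregret
    have h := (hXY k).comp (u := fun x => ENNReal.ofReal (-x)) (by fun_prop)
    exact (h.lintegral_eq).trans_lt (hneg_m k)
  have hsum : ∑ k, ∫ ω, ℓ (X k ω) (Y k ω) ∂μ ≤ (n + 1) * R + D / β := by
    rw [← integral_finsetSum _ fun k _ => hc k]
    refine (integral_mono_ae (integrable_finsetSum _ fun k _ => hc k) hbound hregret).trans_eq ?_
    rw [integral_add (integrable_finsetSum _ fun k _ => hYavg k) (integrable_const _),
      integral_finsetSum _ fun k _ => hYavg k]
    simp [hYavg_eq]
  -- from the forecasts to the estimator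
  have hd : ∀ k, Integrable (fun ω => ℓ (X k ω) (Z ω)) μ := fun k => (hXY k).integrable_iff.1 (hc k)
  have hest_le : ∀ ω, ℓ (est fun i => Zs i ω) (Z ω) ≤
      ∑ k, ((n : ℝ) + 1)⁻¹ * ℓ (X k ω) (Z ω) := fun ω =>
    hM.le_sum_div_of_forall_sum_sq_dist_le (hlsc (Z ω)) hβ (hconc (Z ω)) (fun k => X k ω)
      (hotb fun i => Zs i ω)
  have hdsum : Integrable (fun ω => ∑ k, ((n : ℝ) + 1)⁻¹ * ℓ (X k ω) (Z ω)) μ :=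
    integrable_finsetSum _ fun k _ => (hd k).const_mul _
  have he : Integrable (fun ω => ℓ (est fun i => Zs i ω) (Z ω)) μ :=
    integrable_of_ae_le (hℓ.comp ((hest.comp (measurable_pi_lambda _ hZs)).prodMk hZ)) hneg_est
      hdsum (.of_forall hest_le)
  rw [estimatorRisk, extIntegral_coe he, EReal.coe_le_coe_iff]
  refine (integral_mono he hdsum hest_le).trans ?_
  rw [integral_finsetSum _ fun k _ => (hd k).const_mul _]
  simp_rw [integral_const_mul]
  rw [← Finset.mul_sum, ← Finset.sum_congr rfl fun k _ => (hXY k).integral_eq]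
  refine (mul_le_mul_of_nonneg_left hsum (by positivity)).trans_eq ?_
  field_simp

end OnlineToBatch

/-! ### The two risk bounds -/

theorem mainTheorem4
    {M : Type*} [MetricSpace M] [CompleteSpace M] [MeasurableSpace M] [BorelSpace M]
    (hM : IsNPCSpace M)
    {𝒵 : Type*} [MeasurableSpace 𝒵]
    (ℓ : M → 𝒵 → ℝ) (hℓ : Measurable (Function.uncurry ℓ))
    (hlsc : ∀ z, LowerSemicontinuous (fun x => ℓ x z))
    (β : ℝ) (hβ : 0 < β)
    (hconc : ∀ z, GeodesicallyConcave (fun x => Real.exp (-β * ℓ x z)))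
    (Θ : Set M) (prior : Measure Θ) [IsProbabilityMeasure prior]
    (n : ℕ) (hn : 1 ≤ n)
    -- the batch `Z₁, …, Zₙ` and the generic variable `Z`
    {Ω : Type*} [MeasurableSpace Ω] (μ : Measure Ω) [IsProbabilityMeasure μ]
    (Zs : Fin n → Ω → 𝒵) (Z : Ω → 𝒵)
    (hZs : ∀ i, Measurable (Zs i)) (hZ : Measurable Z)
    (hindep : iIndepFun Zs μ) (hindepZ : IndepFun (fun ω i => Zs i ω) Z μ)
    (hident : ∀ i, IdentDistrib (Zs i) Z μ μ)
    -- the forecasts and the estimator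
    (m : (k : Fin (n + 1)) → (Fin k → 𝒵) → M) (hm : ∀ k, Measurable (m k))
    (hewa : IsEWAForecaster prior β ℓ m)
    (est : (Fin n → 𝒵) → M) (hest : Measurable est)
    (hotb : IsOnlineToBatch m est)
    -- the expectations involved are well defined in `(-∞, +∞]`
    (hneg : ∀ q : ProbabilityMeasure Θ,
      ∫⁻ θ, ∫⁻ ω, ENNReal.ofReal (-ℓ (θ : M) (Z ω)) ∂μ ∂(q : Measure Θ) < ∞)
    (hneg_m : ∀ k, ∫⁻ ω, ENNReal.ofReal
      (-ℓ (m k (outcomePrefix (fun i => Zs i ω) k)) (Z ω)) ∂μ < ∞)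
    (hneg_est : ∫⁻ ω, ENNReal.ofReal (-ℓ (est (fun i => Zs i ω)) (Z ω)) ∂μ < ∞) :
    (estimatorRisk μ ℓ Zs Z est ≤
      ⨅ q : ProbabilityMeasure Θ,
        extIntegral (q : Measure Θ) (fun θ => risk μ ℓ Z (θ : M)) +
          ((InformationTheory.klDiv (q : Measure Θ) prior /
            ENNReal.ofReal (β * (n + 1)) : ℝ≥0∞) : EReal)) ∧
    (∀ L : ℝ≥0, 0 < L → (∀ z, LipschitzWith L (fun x => ℓ x z)) →
      ∀ θstar : Θ, (∀ θ : Θ, risk μ ℓ Z (θstar : M) ≤ risk μ ℓ Z (θ : M)) →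
        risk μ ℓ Z (θstar : M) < ⊤ →
        estimatorRisk μ ℓ Zs Z est - ⨅ θ : Θ, risk μ ℓ Z (θ : M) ≤
          ⨅ q : ProbabilityMeasure Θ,
            (((L : ℝ≥0∞) * ∫⁻ θ, edist (θstar : M) (θ : M) ∂(q : Measure Θ) +
              InformationTheory.klDiv (q : Measure Θ) prior /
                ENNReal.ofReal (β * (n + 1)) : ℝ≥0∞) : EReal)) := by
  have hν : IsProbabilityMeasure (μ.map Z) := Measure.isProbabilityMeasure_map hZ.aemeasurable
  have hℓx : ∀ x, Measurable fun z => ℓ x z := fun x => hℓ.comp measurable_prodMk_left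
  have hrisk : ∀ x, risk μ ℓ Z x = extIntegral (μ.map Z) fun z => (ℓ x z : EReal) := fun x =>
    (extIntegral_coe_map hZ (hℓx x)).symm
  have hF : Measurable (Function.uncurry fun (θ : Θ) z => ℓ θ z) :=
    hℓ.comp (measurable_subtype_coe.prodMap measurable_id)
  have hnegν : ∀ q : ProbabilityMeasure Θ,
      ∫⁻ θ, ∫⁻ z, ENNReal.ofReal (-ℓ (θ : M) z) ∂(μ.map Z) ∂(q : Measure Θ) < ∞ := fun q => by
    have h : ∀ x, ∫⁻ z, ENNReal.ofReal (-ℓ x z) ∂(μ.map Z) =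
        ∫⁻ ω, ENNReal.ofReal (-ℓ x (Z ω)) ∂μ := fun x =>
      lintegral_map (hℓx x).neg.ennreal_ofReal hZ
    simpa only [h] using hneg q
  have hN : 0 < β * ((n : ℝ) + 1) := by positivity
  have main : ∀ q : ProbabilityMeasure Θ, estimatorRisk μ ℓ Zs Z est ≤
      extIntegral (q : Measure Θ) (fun θ => risk μ ℓ Z (θ : M)) +
        ((InformationTheory.klDiv (q : Measure Θ) prior /
          ENNReal.ofReal (β * (n + 1)) : ℝ≥0∞) : EReal) := fun q => by
    simp only [hrisk]
    -- If the divergence or the averaged risk is infinite, the right side is `⊤`: the other term is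
    -- not `⊥`, so `⊥ + ⊤ = ⊥` cannot occur.
    by_cases hkl : InformationTheory.klDiv (q : Measure Θ) prior = ∞
    · rw [hkl, ENNReal.top_div_of_ne_top ENNReal.ofReal_ne_top, EReal.coe_ennreal_top,
        EReal.add_top_of_ne_bot (extIntegral_extIntegral_ne_bot (hnegν q))]
      exact le_top
    by_cases htop : extIntegral (q : Measure Θ)
        (fun θ => extIntegral (μ.map Z) fun z => (ℓ (θ : M) z : EReal)) = ⊤
    · rw [htop, EReal.top_add_of_ne_bot (EReal.coe_ennreal_ne_bot _)]
      exact le_top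
    have hint := integrable_uncurry_of_extIntegral_ne_top hF (hnegν q) htop
    refine (estimatorRisk_le_integral_add hM hℓ hlsc hβ hconc hZs hZ hindep hindepZ hident hm hewa
      hest hotb hneg_m hneg_est hkl hint).trans_eq ?_
    rw [extIntegral_extIntegral_eq_integral hint, EReal.coe_add]
    congr 1
    rw [← EReal.coe_ennreal_toReal (ENNReal.div_ne_top hkl (ENNReal.ofReal_pos.2 hN).ne'),
      ENNReal.toReal_div, ENNReal.toReal_ofReal hN.le]
  refine ⟨le_iInf main, fun L hL hLip θstar hmin hfin => le_iInf fun q => ?_⟩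
  have hinf : ⨅ θ : Θ, risk μ ℓ Z (θ : M) = risk μ ℓ Z (θstar : M) :=
    le_antisymm (iInf_le _ _) (le_iInf hmin)
  have hbot : ∀ θ : Θ, risk μ ℓ Z (θ : M) ≠ ⊥ := fun θ => by
    -- Dirac masses give the finite negative part at each single expert.
    have h := hneg ⟨Measure.dirac θ, Measure.dirac.isProbabilityMeasure⟩
    simp only [ProbabilityMeasure.coe_mk, lintegral_dirac] at h
    rw [risk, extIntegral_coe_eq_lintegral_sub, sub_eq_add_neg, EReal.add_ne_bot_iff]
    simpa using h.ne
  have hint : Integrable (fun z => ℓ (θstar : M) z) (μ.map Z) := by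
    have hbot' := hbot θstar
    have hfin' := hfin.ne
    rw [hrisk, extIntegral_coe_eq_lintegral_sub] at hbot' hfin'
    have hneg' : ∫⁻ z, ENNReal.ofReal (-ℓ (θstar : M) z) ∂(μ.map Z) ≠ ∞ := fun h => by
      simp [h] at hbot'
    refine integrable_of_lintegral_ofReal_lt_top (hℓx _) (lt_top_iff_ne_top.2 fun h => ?_)
      hneg'.lt_top
    rw [h, EReal.coe_ennreal_top] at hfin'
    exact hfin' (EReal.top_sub (by simpa using hneg'))
  have hstar : risk μ ℓ Z (θstar : M) = ((∫ z, ℓ (θstar : M) z ∂(μ.map Z) : ℝ) : EReal) := by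
    rw [hrisk, extIntegral_coe hint]
  have hgrowth : ∀ θ : Θ, risk μ ℓ Z (θ : M) ≤
      ((∫ z, ℓ (θstar : M) z ∂(μ.map Z) + L * dist (θstar : M) (θ : M) : ℝ) : EReal) := fun θ => by
    have h := extIntegral_coe (hint.add (integrable_const (L * dist (θstar : M) (θ : M))))
    simp only [Pi.add_apply] at h
    rw [integral_add hint (integrable_const _), integral_const, probReal_univ, one_smul] at h
    rw [← h, hrisk]
    refine extIntegral_mono_ae (.of_forall fun z => EReal.coe_le_coe_iff.2 ?_)
    have := (le_abs_self _).trans ((hLip z).dist_le_mul (θ : M) (θstar : M))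
    rw [dist_comm]
    linarith
  by_cases hd : ∫⁻ θ, edist (θstar : M) (θ : M) ∂(q : Measure Θ) = ∞
  -- Positivity of `L` matters here, since `0 * ∞ = 0`.
  · rw [hd, ENNReal.mul_top (by simpa using hL.ne'), top_add]
    exact le_top
  have hdist : Integrable (fun θ : Θ => dist (θstar : M) (θ : M)) (q : Measure Θ) := by
    have hm : Measurable fun θ : Θ => dist (θstar : M) (θ : M) :=
      (Continuous.dist continuous_const continuous_subtype_val).measurable
    refine integrable_of_lintegral_ofReal_lt_top hm ?_ ?_
    · simpa only [← edist_dist] using lt_top_iff_ne_top.2 hd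
    · simp [ENNReal.ofReal_of_nonpos]
  have hq : extIntegral (q : Measure Θ) (fun θ => risk μ ℓ Z (θ : M)) ≤
      risk μ ℓ Z (θstar : M) +
        (((L : ℝ≥0∞) * ∫⁻ θ, edist (θstar : M) (θ : M) ∂(q : Measure Θ) : ℝ≥0∞) : EReal) := by
    refine (extIntegral_mono_ae (.of_forall hgrowth)).trans_eq ?_
    have hsum : Integrable (fun θ : Θ =>
        ∫ z, ℓ (θstar : M) z ∂(μ.map Z) + L * dist (θstar : M) (θ : M)) (q : Measure Θ) :=
      (integrable_const _).add (hdist.const_mul _)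
    rw [extIntegral_coe hsum, integral_add (integrable_const _) (hdist.const_mul _),
      integral_const_mul, integral_const,
      probReal_univ, one_smul, EReal.coe_add, hstar]
    simp_rw [edist_dist]
    rw [← ofReal_integral_eq_lintegral_ofReal hdist (.of_forall fun _ => dist_nonneg),
      ← ENNReal.ofReal_coe_nnreal, ← ENNReal.ofReal_mul L.coe_nonneg, EReal.coe_ennreal_ofReal,
      max_eq_left (mul_nonneg L.coe_nonneg (integral_nonneg fun _ => dist_nonneg))]
  rw [hinf, EReal.sub_le_iff_le_add (.inl (hbot θstar)) (.inl hfin.ne)]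
  refine (main q).trans ((add_le_add_left hq _).trans_eq ?_)
  rw [EReal.coe_ennreal_add, add_assoc, add_comm]
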